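/- Let $\mathcal H$ be a complex Hilbert space (scalar product $\langle\cdot,\cdot\rangle$ linear in the second variable) and let $q\in[-1,1]$. Let $\lambda_0,\lambda_1$ be the identity operators on $\mathcal H^{\otimes 0}=\mathbb C$ and $\mathcal H$, let $\lambda_2(f\otimes g)=f\otimes g+q\,g\otimes f$ on $\mathcal H^{\otimes 2}$, and let $\lambda_{n+2}=\mathbf 1^{\otimes n}\otimes\lambda_2$ on $\mathcal H^{\otimes(n+2)}$. Let $\mathcal H_n$ be the completion of $\mathcal H^{\otimes n}$, modulo the kernel of the form, with respect to the positive semidefinite form $\langle F,G\rangle_n=\langle F,\lambda_nG\rangle_{\otimes n}$ (so $\mathcal H_0=\mathbb C$). The $(\mathbf q,2)$-Fock space is the Hilbert space direct sum $\bigoplus_{n\ge0}\mathcal H_n$, with vacuum vector $\Phi=1\oplus0\oplus0\oplus\cdots$. For $f\in\mathcal H$ the creation operator $A^+(f)$ is the bounded linear operator with $A^+(f)\Phi=f$ and $A^+(f)F=f\otimes F$ for $F\in\mathcal H_n$, $n\ge1$; put $A(f)=A^+(f)^*$ and $Q(f)=A(f)+A^+(f)$. **Theorem.** For every $f\in\mathcal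 H$ there is $\epsilon_f>0$ such that the series $$T_q(x)=\sum_{n=0}^\infty x^n\,\langle\Phi,Q(f)^{2n}\Phi\rangle$$ converges absolutely for all $x\in(-\epsilon_f,\epsilon_f)$. Moreover, for every $\epsilon_f>0$ with this property, and for all real $x$ with $|x|<\epsilon_f$ and $4\|f\|^2|x|<1$ (that is, $|x|<\min\{\frac1{4\|f\|^2},\epsilon_f\}$, where $\frac1{4\|f\|^2}=\infty$ if $f=0$), the denominator below is nonzero and $$T_q(x)=\frac{1-q+(1+q)\sqrt{1-4\|f\|^2x}}{1-q+(1+q)\sqrt{1-4\|f\|^2x}-2\|f\|^2x}.$$ -/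

import Mathlib

open scoped TensorProduct InnerProductSpace

noncomputable section

namespace QTwoFock

universe u

variable {H : Type u} [NormedAddCommGroup H] [InnerProductSpace ℂ H]

/-- The linear functional `⟨f₁ ⊗ ⋯ ⊗ fₙ, ·⟩` on `H^{⊗n}`, determined by
`⟨f₁ ⊗ ⋯ ⊗ fₙ, g₁ ⊗ ⋯ ⊗ gₙ⟩ = ∏ i, ⟨fᵢ, gᵢ⟩`. -/
def innerTprod {n : ℕ} (f : Fin n → H) : (⨂[ℂ]^n H) →ₗ[ℂ] ℂ :=
  PiTensorProduct.lift
    ((MultilinearMap.mkPiAlgebra ℂ (Fin n) ℂ).compLinearMap fun i => innerₛₗ ℂ (f i))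

theorem innerTprod_tprod {n : ℕ} (f g : Fin n → H) :
    innerTprod f (PiTensorProduct.tprod ℂ g) = ∏ i, inner ℂ (f i) (g i) := by
  simp [innerTprod]

theorem prod_inner_update {n : ℕ} [DecidableEq (Fin n)] (g v : Fin n → H) (i : Fin n) (x : H) :
    ∏ j, inner ℂ (Function.update g i x j) (v j) =
      inner ℂ x (v i) * ∏ j ∈ {i}ᶜ, inner ℂ (g j) (v j) := by
  rw [Fintype.prod_eq_mul_prod_compl i, Function.update_self]
  congr 1
  refine Finset.prod_congr rfl fun j hj => ?_
  have hj' : j ≠ i := by simpa using hj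
  rw [Function.update_of_ne hj']

/-- Complex conjugation as a conjugate-linear map. -/
def conjMap : ℂ →ₗ⋆[ℂ] ℂ where
  toFun := starRingEnd ℂ
  map_add' := map_add _
  map_smul' c z := by simp

theorem conjMap_apply (z : ℂ) : conjMap z = starRingEnd ℂ z := rfl

/-- `g ↦ ⟨·, g₁ ⊗ ⋯ ⊗ gₙ⟩`, as a multilinear map into the conjugate-linear functionals. -/
def tensorInnerAux (n : ℕ) :
    MultilinearMap ℂ (fun _ : Fin n => H) ((⨂[ℂ]^n H) →ₗ⋆[ℂ] ℂ) where
  toFun g := conjMap.comp (innerTprod g)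
  map_update_add' {hd} g i x y := by
    have : innerTprod (Function.update g i (x + y)) =
        innerTprod (Function.update g i x) + innerTprod (Function.update g i y) := by
      refine PiTensorProduct.ext (MultilinearMap.ext fun v => ?_)
      simp only [LinearMap.compMultilinearMap_apply, innerTprod_tprod, LinearMap.add_apply,
        prod_inner_update, inner_add_left, add_mul]
    ext w
    simp [this]
  map_update_smul' {hd} g i c x := by
    have : innerTprod (Function.update g i (c • x)) =
        starRingEnd ℂ c • innerTprod (Function.update g i x) := by
      refine PiTensorProduct.ext (MultilinearMap.ext fun v => ?_)
      simp only [LinearMap.compMultilinearMap_apply, innerTprod_tprod, LinearMap.smul_apply,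
        prod_inner_update, inner_smul_left, mul_assoc, smul_eq_mul]
    ext w
    simp [this, conjMap_apply]

/-- The standard scalar product `⟨F, G⟩_{⊗n}` on the algebraic tensor power `H^{⊗n}`
(conjugate-linear in `F`, linear in `G`). -/
def tensorInner {n : ℕ} (F G : ⨂[ℂ]^n H) : ℂ :=
  PiTensorProduct.lift (tensorInnerAux n) G F

section tensorInner

variable {n : ℕ}

theorem tensorInner_tprod (f g : Fin n → H) :
    tensorInner (PiTensorProduct.tprod ℂ f) (PiTensorProduct.tprod ℂ g) =
      ∏ i, inner ℂ (f i) (g i) := by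
  simp [tensorInner, tensorInnerAux, innerTprod_tprod, conjMap_apply]

theorem tensorInner_add_left (F F' G : ⨂[ℂ]^n H) :
    tensorInner (F + F') G = tensorInner F G + tensorInner F' G := by
  simp [tensorInner]

theorem tensorInner_add_right (F G G' : ⨂[ℂ]^n H) :
    tensorInner F (G + G') = tensorInner F G + tensorInner F G' := by
  simp [tensorInner]

theorem tensorInner_smul_left (c : ℂ) (F G : ⨂[ℂ]^n H) :
    tensorInner (c • F) G = starRingEnd ℂ c * tensorInner F G := by
  simp [tensorInner]

theorem tensorInner_smul_right (c : ℂ) (F G : ⨂[ℂ]^n H) :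
    tensorInner F (c • G) = c * tensorInner F G := by
  simp [tensorInner]

/-- A property of two tensors that is stable under linear combinations in both of them holds
once it holds for simple tensors. -/
theorem tensor_induction_two {P : (⨂[ℂ]^n H) → (⨂[ℂ]^n H) → Prop}
    (h : ∀ f g : Fin n → H, P (PiTensorProduct.tprod ℂ f) (PiTensorProduct.tprod ℂ g))
    (sl : ∀ (c : ℂ) F G, P F G → P (c • F) G) (sr : ∀ (c : ℂ) F G, P F G → P F (c • G))
    (al : ∀ F F' G, P F G → P F' G → P (F + F') G)
    (ar : ∀ F G G', P F G → P F G' → P F (G + G')) (F G : ⨂[ℂ]^n H) : P F G := by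
  induction F using PiTensorProduct.induction_on with
  | smul_tprod c f =>
    refine sl _ _ _ ?_
    induction G using PiTensorProduct.induction_on with
    | smul_tprod d g => exact sr _ _ _ (h f g)
    | add x y hx hy => exact ar _ _ _ hx hy
  | add x y hx hy => exact al _ _ _ hx hy

theorem tensorInner_conj_symm (F G : ⨂[ℂ]^n H) :
    starRingEnd ℂ (tensorInner G F) = tensorInner F G := by
  refine tensor_induction_two (P := fun F G => starRingEnd ℂ (tensorInner G F) = tensorInner F G)
    ?_ ?_ ?_ ?_ ?_ F G
  · intro f g
    simp [tensorInner_tprod, map_prod]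
  · intro c F G h
    simp [tensorInner_smul_left, tensorInner_smul_right, ← h]
  · intro c F G h
    simp [tensorInner_smul_left, tensorInner_smul_right, ← h]
  · intro F F' G h h'
    simp [tensorInner_add_left, tensorInner_add_right, ← h, ← h']
  · intro F G G' h h'
    simp [tensorInner_add_left, tensorInner_add_right, ← h, ← h']

theorem tensorInner_sum_left {ι : Type*} (s : Finset ι) (X : ι → ⨂[ℂ]^n H) (G : ⨂[ℂ]^n H) :
    tensorInner (∑ a ∈ s, X a) G = ∑ a ∈ s, tensorInner (X a) G := by
  simp [tensorInner]

theorem tensorInner_sum_right {ι : Type*} (s : Finset ι) (X : ι → ⨂[ℂ]^n H) (G : ⨂[ℂ]^n H) :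
    tensorInner G (∑ a ∈ s, X a) = ∑ a ∈ s, tensorInner G (X a) := by
  simp [tensorInner]

open scoped ComplexOrder in
theorem posSemidef_prod_inner {ι : Type*} [Finite ι] (v : ι → Fin n → H) (s : Finset (Fin n)) :
    (Matrix.of fun a b : ι => ∏ i ∈ s, inner ℂ (v a i) (v b i)).PosSemidef := by
  induction s using Finset.induction_on with
  | empty =>
    have := Matrix.posSemidef_gram ℂ (fun _ : ι => (1 : ℂ))
    convert! this using 1
    ext f g
    simp [Matrix.gram]
  | insert a s ha ih =>
    have := (Matrix.posSemidef_gram ℂ (fun f : ι => v f a)).hadamard ih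
    convert! this using 1
    ext f g
    simp [Matrix.gram, Finset.prod_insert ha]

open scoped ComplexOrder in
theorem tensorInner_self_nonneg (F : ⨂[ℂ]^n H) : 0 ≤ (tensorInner F F).re := by
  have hF : F ∈ Submodule.span ℂ
      (Set.range (PiTensorProduct.tprod ℂ (s := fun _ : Fin n => H))) := by
    rw [PiTensorProduct.span_tprod_eq_top]; trivial
  obtain ⟨c, rfl⟩ := Finsupp.mem_span_range_iff_exists_finsupp.mp hF
  have h := (posSemidef_prod_inner (fun f : c.support => (f : Fin n → H))
    Finset.univ).dotProduct_mulVec_nonneg (fun f => c f)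
  have key : tensorInner (c.sum fun f a => a • PiTensorProduct.tprod ℂ f)
      (c.sum fun f a => a • PiTensorProduct.tprod ℂ f) =
      star (fun f : c.support => c f) ⬝ᵥ (Matrix.of fun f g : c.support =>
        ∏ i, inner ℂ ((f : Fin n → H) i) ((g : Fin n → H) i)).mulVec (fun f => c f) := by
    simp only [Finsupp.sum, tensorInner_sum_left, tensorInner_sum_right, tensorInner_smul_left,
      tensorInner_smul_right, tensorInner_tprod, dotProduct, Matrix.mulVec, Matrix.of_apply,
      Pi.star_apply, Finset.mul_sum]
    rw [Finset.sum_comm, ← Finset.sum_coe_sort]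
    refine Finset.sum_congr rfl fun f _ => ?_
    rw [← Finset.sum_coe_sort]
    refine Finset.sum_congr rfl fun g _ => ?_
    simp only [starRingEnd_apply]
    ring
  rw [key]
  exact (Complex.le_def.mp h).1

end tensorInner

/-- The exchange `f₁ ⊗ ⋯ ⊗ fₙ ⊗ f ⊗ g ↦ f₁ ⊗ ⋯ ⊗ fₙ ⊗ g ⊗ f` of the last two factors. -/
def swapLast (n : ℕ) : (⨂[ℂ]^(n + 2) H) →ₗ[ℂ] (⨂[ℂ]^(n + 2) H) :=
  (PiTensorProduct.reindex ℂ (fun _ : Fin (n + 2) => H)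
    (Equiv.swap (Fin.last n).castSucc (Fin.last (n + 1)))).toLinearMap

theorem swapLast_tprod {n : ℕ} (f : Fin (n + 2) → H) :
    swapLast n (PiTensorProduct.tprod ℂ f) = PiTensorProduct.tprod ℂ
      (fun i => f (Equiv.swap (Fin.last n).castSucc (Fin.last (n + 1)) i)) := by
  simp [swapLast, PiTensorProduct.reindex_tprod]

/-- The operator `λₙ` on `H^{⊗n}`: the identity for `n ≤ 1`, and `1^{⊗n} ⊗ λ₂` on `H^{⊗(n+2)}`,
where `λ₂ (f ⊗ g) = f ⊗ g + q g ⊗ f`. -/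
def lam (q : ℝ) : (n : ℕ) → (⨂[ℂ]^n H) →ₗ[ℂ] (⨂[ℂ]^n H)
  | 0 => LinearMap.id
  | 1 => LinearMap.id
  | n + 2 => LinearMap.id + (q : ℂ) • swapLast n

theorem tensorInner_swapLast_left {n : ℕ} (F G : ⨂[ℂ]^(n + 2) H) :
    tensorInner (swapLast n F) G = tensorInner F (swapLast n G) := by
  refine tensor_induction_two
    (P := fun F G => tensorInner (swapLast n F) G = tensorInner F (swapLast n G))
    ?_ ?_ ?_ ?_ ?_ F G
  · intro f g
    rw [swapLast_tprod, swapLast_tprod, tensorInner_tprod, tensorInner_tprod]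
    refine Fintype.prod_equiv (Equiv.swap (Fin.last n).castSucc (Fin.last (n + 1))) _ _ ?_
    intro i
    simp
  · intro c F G h
    simp [tensorInner_smul_left, h]
  · intro c F G h
    simp [tensorInner_smul_right, h]
  · intro F F' G h h'
    simp [tensorInner_add_left, h, h']
  · intro F G G' h h'
    simp [tensorInner_add_right, h, h']

theorem swapLast_swapLast {n : ℕ} (F : ⨂[ℂ]^(n + 2) H) : swapLast n (swapLast n F) = F := by
  have : (swapLast n).comp (swapLast n) = (LinearMap.id : (⨂[ℂ]^(n + 2) H) →ₗ[ℂ] _) := by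
    refine PiTensorProduct.ext (MultilinearMap.ext fun v => ?_)
    simp [swapLast_tprod]
  exact LinearMap.congr_fun this F

theorem abs_tensorInner_swapLast_le {n : ℕ} (F : ⨂[ℂ]^(n + 2) H) :
    |(tensorInner F (swapLast n F)).re| ≤ (tensorInner F F).re := by
  have e : tensorInner (swapLast n F) (swapLast n F) = tensorInner F F := by
    rw [tensorInner_swapLast_left, swapLast_swapLast]
  have h1 := tensorInner_self_nonneg (F + swapLast n F)
  have h2 := tensorInner_self_nonneg (F + (-1 : ℂ) • swapLast n F)
  simp only [tensorInner_add_left, tensorInner_add_right, tensorInner_smul_left,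
    tensorInner_smul_right, e, tensorInner_swapLast_left] at h1 h2
  simp at h1 h2
  rw [abs_le]
  constructor <;> linarith

/-- The form `⟨F, G⟩ₙ = ⟨F, λₙ G⟩_{⊗n}` on `H^{⊗n}`. -/
def qInner (q : ℝ) {n : ℕ} (F G : ⨂[ℂ]^n H) : ℂ :=
  tensorInner F (lam q n G)

theorem qInner_conj_symm (q : ℝ) {n : ℕ} (F G : ⨂[ℂ]^n H) :
    starRingEnd ℂ (qInner q G F) = qInner q F G := by
  match n with
  | 0 => exact tensorInner_conj_symm F G
  | 1 => exact tensorInner_conj_symm F G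
  | n + 2 =>
    simp only [qInner, lam, LinearMap.add_apply, LinearMap.smul_apply, LinearMap.id_apply,
      tensorInner_add_right, tensorInner_smul_right, map_add, map_mul, tensorInner_conj_symm,
      Complex.conj_ofReal, tensorInner_swapLast_left]

theorem qInner_self_nonneg {q : ℝ} (hq : q ∈ Set.Icc (-1 : ℝ) 1) {n : ℕ} (F : ⨂[ℂ]^n H) :
    0 ≤ (qInner q F F).re := by
  match n with
  | 0 => exact tensorInner_self_nonneg F
  | 1 => exact tensorInner_self_nonneg F
  | n + 2 =>
    have h := abs_tensorInner_swapLast_le F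
    have hq' : |q| ≤ 1 := abs_le.mpr hq
    simp only [qInner, lam, LinearMap.add_apply, LinearMap.smul_apply, LinearMap.id_apply,
      tensorInner_add_right, tensorInner_smul_right, Complex.add_re, Complex.re_ofReal_mul]
    have h2 : |q * (tensorInner F (swapLast n F)).re| ≤ (tensorInner F F).re := by
      rw [abs_mul]
      calc _ ≤ 1 * (tensorInner F F).re := by gcongr
        _ = _ := one_mul _
    linarith [neg_abs_le (q * (tensorInner F (swapLast n F)).re)]

/-- The map `F ↦ f ⊗ F` from `H^{⊗n}` to `H^{⊗(n+1)}`. -/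
def consTensor (f : H) (n : ℕ) : (⨂[ℂ]^n H) →ₗ[ℂ] (⨂[ℂ]^(n + 1) H) :=
  PiTensorProduct.lift
    ((PiTensorProduct.tprod ℂ (s := fun _ : Fin (n + 1) => H)).curryLeft f)

theorem consTensor_tprod (f : H) {n : ℕ} (g : Fin n → H) :
    consTensor f n (PiTensorProduct.tprod ℂ g) =
      PiTensorProduct.tprod ℂ (Fin.cons f g : Fin (n + 1) → H) := by
  simp [consTensor]

theorem tensorInner_consTensor (f g : H) {n : ℕ} (F G : ⨂[ℂ]^n H) :
    tensorInner (consTensor f n F) (consTensor g n G) = inner ℂ f g * tensorInner F G := by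
  refine tensor_induction_two
    (P := fun F G => tensorInner (consTensor f n F) (consTensor g n G) =
      inner ℂ f g * tensorInner F G) ?_ ?_ ?_ ?_ ?_ F G
  · intro v w
    simp [consTensor_tprod, tensorInner_tprod, Fin.prod_univ_succ]
  · intro c F G h
    rw [map_smul, tensorInner_smul_left, tensorInner_smul_left, h]; ring
  · intro c F G h
    rw [map_smul, tensorInner_smul_right, tensorInner_smul_right, h]; ring
  · intro F F' G h h'
    rw [map_add, tensorInner_add_left, tensorInner_add_left, h, h']; ring
  · intro F G G' h h'
    rw [map_add, tensorInner_add_right, tensorInner_add_right, h, h']; ring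

theorem swapLast_consTensor (f : H) {n : ℕ} (F : ⨂[ℂ]^(n + 2) H) :
    swapLast (n + 1) (consTensor f (n + 2) F) = consTensor f (n + 2) (swapLast n F) := by
  have : (swapLast (n + 1)).comp (consTensor f (n + 2)) =
      (consTensor f (n + 2)).comp (swapLast n) := by
    refine PiTensorProduct.ext (MultilinearMap.ext fun v => ?_)
    simp only [LinearMap.compMultilinearMap_apply, LinearMap.comp_apply, consTensor_tprod,
      swapLast_tprod]
    congr 1
    ext i
    rw [← Fin.succ_last (n + 1), show (Fin.last (n + 1)).castSucc = (Fin.last n).castSucc.succ from rfl]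
    refine Fin.cases ?_ (fun j => ?_) i
    · rw [Equiv.swap_apply_of_ne_of_ne (Fin.succ_ne_zero _).symm (Fin.succ_ne_zero _).symm]
      simp
    · rw [← (Fin.succ_injective _).map_swap]
      simp
  exact LinearMap.congr_fun this F

/-- The creation estimate `‖f ⊗ F‖ₙ₊₁² ≤ 2 ‖f‖² ‖F‖ₙ²`. -/
theorem qInner_consTensor_le {q : ℝ} (hq : q ∈ Set.Icc (-1 : ℝ) 1) (f : H) {n : ℕ}
    (F : ⨂[ℂ]^n H) :
    (qInner q (consTensor f n F) (consTensor f n F)).re ≤ 2 * ‖f‖ ^ 2 * (qInner q F F).re := by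
  have key : ∀ G : ⨂[ℂ]^n H, (tensorInner (consTensor f n F) (consTensor f n G)).re =
      ‖f‖ ^ 2 * (tensorInner F G).re := by
    intro G
    rw [tensorInner_consTensor, inner_self_eq_norm_sq_to_K]
    norm_cast
    exact Complex.re_ofReal_mul _ _
  have hpos := mul_nonneg (sq_nonneg ‖f‖) (qInner_self_nonneg hq F)
  match n with
  | 0 =>
    have : (qInner q (consTensor f 0 F) (consTensor f 0 F)).re =
      ‖f‖ ^ 2 * (qInner q F F).re := key F
    linarith
  | 1 =>
    have h := abs_tensorInner_swapLast_le (consTensor f 1 F)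
    have hq' : |q| ≤ 1 := abs_le.mpr hq
    rw [key] at h
    have h2 : |q * (tensorInner (consTensor f 1 F) (swapLast 0 (consTensor f 1 F))).re| ≤
        ‖f‖ ^ 2 * (tensorInner F F).re := by
      rw [abs_mul]
      calc _ ≤ 1 * (‖f‖ ^ 2 * (tensorInner F F).re) := by gcongr
        _ = _ := one_mul _
    have h3 := (abs_le.mp h2).2
    have e : (qInner q F F).re = (tensorInner F F).re := rfl
    have e' : (qInner q (consTensor f 1 F) (consTensor f 1 F)).re =
        ‖f‖ ^ 2 * (tensorInner F F).re +
          q * (tensorInner (consTensor f 1 F) (swapLast 0 (consTensor f 1 F))).re := by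
      simp only [qInner, lam, LinearMap.add_apply, LinearMap.smul_apply, LinearMap.id_apply,
        tensorInner_add_right, tensorInner_smul_right, Complex.add_re, Complex.re_ofReal_mul, key]
    rw [e, e']
    linarith
  | n + 2 =>
    have e : (qInner q (consTensor f (n + 2) F) (consTensor f (n + 2) F)).re =
        ‖f‖ ^ 2 * (qInner q F F).re := by
      simp only [qInner, lam, LinearMap.add_apply, LinearMap.smul_apply, LinearMap.id_apply,
        tensorInner_add_right, tensorInner_smul_right, Complex.add_re, Complex.re_ofReal_mul,
        swapLast_consTensor, key]
      ring
    rw [e]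
    linarith

/-- The space `H^{⊗n}`, to be equipped with the positive semidefinite form `⟨·, ·⟩ₙ`. -/
def PreParticle (_q : Set.Icc (-1 : ℝ) 1) (H : Type u) [NormedAddCommGroup H]
    [InnerProductSpace ℂ H] (n : ℕ) : Type u :=
  ⨂[ℂ]^n H

namespace PreParticle

variable (q : Set.Icc (-1 : ℝ) 1) (n : ℕ)

instance instAddCommGroup : AddCommGroup (PreParticle q H n) :=
  inferInstanceAs (AddCommGroup (⨂[ℂ]^n H))

instance instModule : Module ℂ (PreParticle q H n) :=
  inferInstanceAs (Module ℂ (⨂[ℂ]^n H))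

/-- The positive semidefinite form `⟨·, ·⟩ₙ` on `H^{⊗n}`. -/
@[reducible]
def core : PreInnerProductSpace.Core ℂ (PreParticle q H n) where
  inner F G := qInner (q : ℝ) (n := n) F G
  conj_inner_symm F G := qInner_conj_symm (q : ℝ) (n := n) F G
  re_inner_nonneg F := qInner_self_nonneg q.2 (n := n) F
  add_left F F' _ := tensorInner_add_left (n := n) F F' _
  smul_left F _ c := tensorInner_smul_left (n := n) c F _

instance instSeminormedAddCommGroup : SeminormedAddCommGroup (PreParticle q H n) :=
  @InnerProductSpace.Core.toSeminormedAddCommGroup ℂ _ _ _ _ (core q n)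

instance instInnerProductSpace : InnerProductSpace ℂ (PreParticle q H n) :=
  InnerProductSpace.ofCore (core q n)

theorem inner_eq (F G : PreParticle q H n) : inner ℂ F G = qInner (q : ℝ) (n := n) F G := rfl

theorem norm_sq_eq (F : PreParticle q H n) : ‖F‖ ^ 2 = (qInner (q : ℝ) (n := n) F F).re := by
  rw [← inner_eq]
  exact norm_sq_eq_re_inner (𝕜 := ℂ) F

end PreParticle

/-- The `n`-particle space `Hₙ`: the (Hausdorff) completion of `H^{⊗n}` with respect to the
positive semidefinite form `⟨·, ·⟩ₙ`, i.e. the completion of the quotient of `H^{⊗n}` by the kernel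
of that form. For `n = 0` this is the one-dimensional space `H^{⊗0}`, spanned by the unit vector
given by the empty tensor. -/
abbrev Particle (q : Set.Icc (-1 : ℝ) 1) (H : Type u) [NormedAddCommGroup H]
    [InnerProductSpace ℂ H] (n : ℕ) : Type u :=
  UniformSpace.Completion (PreParticle q H n)

/-- The `(q,2)`-Fock space: the Hilbert space direct sum of the `n`-particle spaces. -/
abbrev Fock (q : Set.Icc (-1 : ℝ) 1) (H : Type u) [NormedAddCommGroup H]
    [InnerProductSpace ℂ H] : Type u :=
  lp (fun n => Particle q H n) 2

variable (q : Set.Icc (-1 : ℝ) 1)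

/-- The class of the simple tensor `f₁ ⊗ ⋯ ⊗ fₙ` in the `n`-particle space. -/
def simpleTensor {n : ℕ} (f : Fin n → H) : Particle q H n :=
  UniformSpace.Completion.coe' (show PreParticle q H n from PiTensorProduct.tprod ℂ f)

/-- The vacuum vector `Φ = 1 ⊕ 0 ⊕ 0 ⊕ ⋯`; the unit of `H^{⊗0}` is the empty tensor. -/
def vacuum : Fock q H :=
  lp.single 2 0 (simpleTensor q (Fin.elim0 : Fin 0 → H))

/-- `F ↦ f ⊗ F` as a bounded operator from `H^{⊗n}` with `⟨·, ·⟩ₙ` to `H^{⊗(n+1)}` with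
`⟨·, ·⟩ₙ₊₁`. -/
def preCreation (f : H) (n : ℕ) : PreParticle q H n →L[ℂ] PreParticle q H (n + 1) :=
  LinearMap.mkContinuous
    (show PreParticle q H n →ₗ[ℂ] PreParticle q H (n + 1) from consTensor f n) (2 * ‖f‖) (by
      intro F
      refine le_of_sq_le_sq ?_ (by positivity)
      have h := qInner_consTensor_le q.2 f (n := n) F
      rw [mul_pow, PreParticle.norm_sq_eq, PreParticle.norm_sq_eq]
      have h' := mul_nonneg (sq_nonneg ‖f‖) (qInner_self_nonneg q.2 (n := n) F)
      refine h.trans ?_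
      nlinarith)

/-- `F ↦ f ⊗ F` as a bounded operator from the `n`- to the `(n+1)`-particle space. -/
def particleCreation (f : H) (n : ℕ) : Particle q H n →L[ℂ] Particle q H (n + 1) :=
  (preCreation q f n).completion

theorem particleCreation_simpleTensor (f : H) {n : ℕ} (g : Fin n → H) :
    particleCreation q f n (simpleTensor q g) =
      simpleTensor q (Fin.cons f g : Fin (n + 1) → H) := by
  refine (ContinuousLinearMap.completion_apply_coe (preCreation q f n) _).trans ?_
  exact congrArg _ (consTensor_tprod f g)

theorem norm_particleCreation_le (f : H) (n : ℕ) (F : Particle q H n) :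
    ‖particleCreation q f n F‖ ≤ 2 * ‖f‖ * ‖F‖ := by
  induction F using UniformSpace.Completion.induction_on with
  | hp => exact isClosed_le (by fun_prop) (by fun_prop)
  | ih F =>
    rw [particleCreation, ContinuousLinearMap.completion_apply_coe,
      UniformSpace.Completion.norm_coe, UniformSpace.Completion.norm_coe]
    exact (preCreation q f n).le_of_opNorm_le
      (LinearMap.mkContinuous_norm_le _ (by positivity) _) F

/-- The sequence `0 ⊕ (f ⊗ ψ₀) ⊕ (f ⊗ ψ₁) ⊕ ⋯`. -/
def creationSeq (f : H) (ψ : (n : ℕ) → Particle q H n) : (n : ℕ) → Particle q H n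
  | 0 => 0
  | n + 1 => particleCreation q f n (ψ n)

theorem hasSum_norm_sq (ψ : Fock q H) :
    HasSum (fun n => ‖ψ n‖ ^ 2) (‖ψ‖ ^ 2) := by
  have := lp.hasSum_norm (p := 2) (by norm_num) ψ
  simpa using this

theorem summable_creationSeq (f : H) (ψ : Fock q H) :
    Summable fun n => ‖creationSeq q f ψ n‖ ^ 2 := by
  rw [← summable_nat_add_iff 1]
  refine Summable.of_nonneg_of_le (fun n => by positivity) (fun n => ?_)
    ((hasSum_norm_sq q ψ).summable.mul_left ((2 * ‖f‖) ^ 2))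
  rw [← mul_pow]
  exact pow_le_pow_left₀ (norm_nonneg _) (norm_particleCreation_le q f n (ψ n)) 2

/-- The creation operator `A⁺(f)` on the `(q,2)`-Fock space: the bounded linear operator that maps
`Φ` to `f` and `F ∈ Hₙ` to `f ⊗ F ∈ Hₙ₊₁`. -/
def creation (f : H) : Fock q H →L[ℂ] Fock q H :=
  LinearMap.mkContinuous (𝕜 := ℂ)
    { toFun := fun ψ => ⟨creationSeq q f ψ, memℓp_gen (by simpa using summable_creationSeq q f ψ)⟩
      map_add' := fun ψ φ => by
        ext n
        cases n with
        | zero => exact (add_zero _).symm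
        | succ n => exact map_add (particleCreation q f n) (ψ n) (φ n)
      map_smul' := fun c ψ => by
        ext n
        cases n with
        | zero => exact (smul_zero (A := Particle q H 0) c).symm
        | succ n => exact map_smul (particleCreation q f n) c (ψ n) }
    (2 * ‖f‖) (by
      intro ψ
      refine le_of_sq_le_sq ?_ (by positivity)
      rw [← (hasSum_norm_sq q _).tsum_eq, mul_pow,
        ← (hasSum_norm_sq q ψ).tsum_eq, ← tsum_mul_left]
      change ∑' n, ‖creationSeq q f ψ n‖ ^ 2 ≤ _
      rw [(summable_creationSeq q f ψ).tsum_eq_zero_add]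
      simp only [creationSeq, norm_zero, ne_eq, OfNat.ofNat_ne_zero, not_false_eq_true, zero_pow,
        zero_add]
      refine Summable.tsum_le_tsum (fun n => ?_)
        ((summable_nat_add_iff 1).mpr (summable_creationSeq q f ψ))
        ((hasSum_norm_sq q ψ).summable.mul_left _)
      rw [← mul_pow]
      exact pow_le_pow_left₀ (norm_nonneg _) (norm_particleCreation_le q f n (ψ n)) 2)

/-- The annihilation operator `A(f)`, the adjoint of `A⁺(f)`. -/
def annihilation (f : H) : Fock q H →L[ℂ] Fock q H :=
  ContinuousLinearMap.adjoint (creation q f)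

/-- The field operator `Q(f) = A(f) + A⁺(f)`. -/
def field (f : H) : Fock q H →L[ℂ] Fock q H :=
  annihilation q f + creation q f

/-- The vacuum moment `uₙ = ⟨Φ, Q(f)^{2n} Φ⟩` of `Q(f)²`. -/
def moment (f : H) (n : ℕ) : ℂ :=
  inner ℂ (vacuum q : Fock q H) ((field q f ^ (2 * n)) (vacuum q))

end QTwoFock

end

/-! Put c = ‖f‖² and p k N = ⟨f^{⊗k}, Q(f)^N Φ⟩, so that the moments are p 0 (2n). On the left side
of the scalar product, A(f) becomes A⁺(f), which raises f^{⊗k} to f^{⊗(k+1)}. The A⁺(f) part of Q(f)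
lowers it: exchanging the last two factors fixes f^{⊗n}, so λₙ acts on it as a scalar, and
⟨f^{⊗(k+1)}, f ⊗ F⟩ is a multiple of ⟨f^{⊗k}, F⟩ (`qInner_tprod_const_consTensor`). No explicit
formula for A(f) is needed.

Thus p obeys the recurrence of a Jacobi matrix with squared weights c, (1 + q)c, c, c, …. Counting
weighted paths (`eq_coeff_levelSeries`, `moment_eq_coeff`), the formal moment series is the
continued fraction M = 1 / (1 - cX/E), E = 1 - (1 + q)cX S, whose constant tail S is the Catalan
series in cX.

Cleared of inverses this reads M (E - cX) = E (`momentSeries_mul`). Evaluating it at x requires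
convergence of S only, which holds for 4c|x| < 1 (`exists_hasSumAt_scaledCatalan`), and of M, which
is assumed. Since 2cx S(x) = 1 - √(1 - 4cx), doubling the identity gives the formula up to division;
the same identity shows that the denominator cannot vanish. -/

namespace QTwoFock

/-! ### Evaluation of formal power series at a point. -/

section PowerSeries

open PowerSeries

/-- The power series `A` converges absolutely at `x`, with sum `a`. -/
def HasSumAt (x : ℂ) (A : PowerSeries ℂ) (a : ℂ) : Prop :=
  HasSum (fun n => x ^ n * coeff n A) a

namespace HasSumAt

variable {x a b : ℂ} {A B : PowerSeries ℂ}

theorem add (hA : HasSumAt x A a) (hB : HasSumAt x B b) : HasSumAt x (A + B) (a + b) := by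
  simpa [HasSumAt, mul_add] using HasSum.add hA hB

theorem sub (hA : HasSumAt x A a) (hB : HasSumAt x B b) : HasSumAt x (A - B) (a - b) := by
  simpa [HasSumAt, mul_sub] using HasSum.sub hA hB

/-- Cauchy product: summability in ℂ is absolute, as Mertens-type rearrangement requires. -/
theorem mul (hA : HasSumAt x A a) (hB : HasSumAt x B b) : HasSumAt x (A * B) (a * b) := by
  have hA' := hA.summable.norm
  have hB' := hB.summable.norm
  have e : (fun n => x ^ n * coeff n (A * B)) = fun n =>
      ∑ kl ∈ Finset.HasAntidiagonal.antidiagonal n, (x ^ kl.1 * coeff kl.1 A) * (x ^ kl.2 * coeff kl.2 B) := by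
    ext n
    rw [coeff_mul, Finset.mul_sum]
    refine Finset.sum_congr rfl fun kl h => ?_
    rw [← Finset.HasAntidiagonal.mem_antidiagonal.mp h]
    ring
  rw [HasSumAt, e, ← HasSum.tsum_eq hA, ← HasSum.tsum_eq hB,
    tsum_mul_tsum_eq_tsum_sum_antidiagonal_of_summable_norm hA' hB']
  exact (summable_norm_sum_mul_antidiagonal_of_summable_norm hA' hB').of_norm.hasSum

theorem monomial (x : ℂ) (n : ℕ) (c : ℂ) : HasSumAt x (monomial n c) (x ^ n * c) := by
  have : x ^ n * c = x ^ n * coeff n (PowerSeries.monomial n c) := by simp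
  rw [this]
  refine hasSum_single n fun m hm => ?_
  simp [coeff_monomial, hm]

theorem C (x c : ℂ) : HasSumAt x (C c) c := by
  simpa using monomial x 0 c

theorem one (x : ℂ) : HasSumAt x 1 1 := by
  simpa using C x 1

theorem X (x : ℂ) : HasSumAt x X x := by
  simpa [X_eq] using monomial x 1 1

theorem unique (h : HasSumAt x A a) (h' : HasSumAt x A b) : a = b := HasSum.unique h h'

end HasSumAt

/-! ### The Catalan generating function and its value. -/

/-- The Catalan generating function in the variable `c X`. -/
noncomputable def scaledCatalan (c : ℂ) : PowerSeries ℂ :=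
  rescale c (map (Nat.castRingHom ℂ) catalanSeries)

theorem coeff_scaledCatalan (c : ℂ) (n : ℕ) :
    coeff n (scaledCatalan c) = c ^ n * catalan n := by
  simp [scaledCatalan]

theorem scaledCatalan_eq (c : ℂ) :
    scaledCatalan c = 1 + C c * X * scaledCatalan c ^ 2 := by
  have := congrArg (fun A => rescale c (map (Nat.castRingHom ℂ) A)) catalanSeries_sq_mul_X_add_one
  simp only [map_add, map_mul, map_pow, map_X, map_one, rescale_X] at this
  rw [scaledCatalan]
  linear_combination -this

/-- The sum telescopes: with B the central binomial coefficients, B_{N+1} = 4 B_N - 2 C_N. It bounds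
the Catalan series on the whole disc of radius 1/4 without asymptotics. -/
theorem sum_catalan_div_four_pow (N : ℕ) :
    ∑ n ∈ Finset.range N, 2 * (catalan n : ℝ) / 4 ^ (n + 1) = 1 - N.centralBinom / 4 ^ N := by
  induction N with
  | zero => simp
  | succ N ih =>
    have h1 : ((N + 1 : ℕ) : ℝ) * catalan N = N.centralBinom := by
      exact_mod_cast succ_mul_catalan_eq_centralBinom N
    have h2 : ((N + 1 : ℕ) : ℝ) * (N + 1).centralBinom = 2 * (2 * N + 1) * N.centralBinom := by
      exact_mod_cast Nat.succ_mul_centralBinom_succ N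
    have h3 : ((N + 1).centralBinom : ℝ) = 4 * N.centralBinom - 2 * catalan N := by
      have h0 : ((N + 1 : ℕ) : ℝ) ≠ 0 := by positivity
      refine mul_left_cancel₀ h0 ?_
      rw [h2]
      push_cast at h1 ⊢
      linear_combination 2 * h1
    rw [Finset.sum_range_succ, ih, h3]
    field_simp
    ring

/-- Evaluation of the Catalan generating function: `2 y S(y) = 1 - √(1 - 4 y)` for `4 |y| < 1`. -/
theorem exists_hasSumAt_scaledCatalan {c x : ℝ} (h : 4 * |c * x| < 1) :
    ∃ s : ℂ, HasSumAt x (scaledCatalan c) s ∧ 2 * (c * x) * s = 1 - (√(1 - 4 * (c * x)) : ℝ) := by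
  set y := c * x with hy
  -- Compare |y|^n with 4^{-n} = 2 · 2 / 4^{n+1} and telescope; the bound 2 is S(1/4).
  have hb : ∀ N, ∑ n ∈ Finset.range N, ‖(catalan n : ℝ) * y ^ n‖ ≤ 2 := by
    intro N
    calc _ ≤ ∑ n ∈ Finset.range N, 2 * (2 * (catalan n : ℝ) / 4 ^ (n + 1)) := by
          refine Finset.sum_le_sum fun n _ => ?_
          have hp : |y| ^ n ≤ (1 / 4) ^ n := pow_le_pow_left₀ (abs_nonneg y) (by linarith) n
          rw [norm_mul, norm_pow, Real.norm_eq_abs, Real.norm_eq_abs, Nat.abs_cast]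
          calc _ ≤ (catalan n : ℝ) * (1 / 4) ^ n := by gcongr
            _ = _ := by rw [one_div, inv_pow, pow_succ]; field_simp; norm_num
      _ = 2 * (1 - N.centralBinom / 4 ^ N) := by
          rw [← Finset.mul_sum, sum_catalan_div_four_pow]
      _ ≤ 2 := by
          have : (0 : ℝ) ≤ N.centralBinom / 4 ^ N := by positivity
          linarith
  have hsn : Summable fun n => ‖(catalan n : ℝ) * y ^ n‖ :=
    summable_of_sum_range_le (fun n => norm_nonneg _) hb
  have hs := hsn.of_norm.hasSum
  set s := ∑' n, (catalan n : ℝ) * y ^ n with hsdef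
  have hsum : HasSumAt x (scaledCatalan c) (s : ℂ) := by
    have := Complex.hasSum_ofReal.mpr hs
    rw [HasSumAt]
    convert this using 2 with n
    rw [coeff_scaledCatalan, hy]
    push_cast
    ring
  have hs2 : |s| ≤ 2 := by
    calc |s| = ‖s‖ := rfl
      _ ≤ _ := norm_tsum_le_tsum_norm hsn
      _ ≤ 2 := Real.tsum_le_of_sum_range_le (fun n => norm_nonneg _) hb
  have hquad : s = 1 + y * s ^ 2 := by
    have h1 := (HasSumAt.one x).add
      ((((HasSumAt.C x c).mul (HasSumAt.X x)).mul (hsum.mul hsum)))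
    rw [← sq, ← scaledCatalan_eq] at h1
    have := hsum.unique h1
    rw [hy, sq]
    exact_mod_cast this
  -- The quadratic equation gives (1 - 2ys)² = 1 - 4y; the bound |ys| ≤ 1/2 selects the nonnegative
  -- root.
  have hpos : 0 ≤ 1 - 2 * y * s := by
    have : |y * s| ≤ 1 / 4 * 2 := by
      rw [abs_mul]
      exact mul_le_mul (by linarith) hs2 (abs_nonneg _) (by norm_num)
    linarith [le_abs_self (y * s)]
  have hsqrt : √(1 - 4 * y) = 1 - 2 * y * s := by
    rw [← Real.sqrt_sq hpos]
    congr 1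
    linear_combination 4 * y * hquad
  refine ⟨s, hsum, ?_⟩
  rw [hsqrt, hy]
  push_cast
  ring

end PowerSeries

/-! ### Paths with Jacobi weights and the continued fraction. -/

section Jacobi

open PowerSeries

/-- The squared weights `c, (1 + q) c, c, c, …` of the Jacobi matrix of `Q(f)`; `weight q c k`
belongs to the step from level `k` to level `k + 1`. -/
def weight (q c : ℂ) : ℕ → ℂ
  | 1 => (1 + q) * c
  | _ => c

variable (q c : ℂ)

/-- `1 - (1 + q) c X S`, where `S` is the Catalan generating function in the variable `c X`. -/
noncomputable def levelOneDenom : PowerSeries ℂ :=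
  1 - C ((1 + q) * c) * X * scaledCatalan c

/-- The continued fraction `1 / (1 - c X / (1 - (1 + q) c X S))`. -/
noncomputable def momentSeries : PowerSeries ℂ :=
  (1 - C c * X * (levelOneDenom q c)⁻¹)⁻¹

/-- The generating functions of the weighted paths from level `k` to level `0`. -/
noncomputable def levelSeries : ℕ → PowerSeries ℂ
  | 0 => momentSeries q c
  | k + 1 => momentSeries q c * (levelOneDenom q c)⁻¹ * scaledCatalan c ^ k

theorem levelOneDenom_mul_inv : levelOneDenom q c * (levelOneDenom q c)⁻¹ = 1 :=
  PowerSeries.mul_inv_cancel _ (by simp [levelOneDenom])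

theorem momentSeries_eq :
    momentSeries q c = 1 + C c * X * (momentSeries q c * (levelOneDenom q c)⁻¹) := by
  have : (1 - C c * X * (levelOneDenom q c)⁻¹) * momentSeries q c = 1 :=
    PowerSeries.mul_inv_cancel _ (by simp)
  linear_combination this

/-- This form is free of inverses, so it can be evaluated at a point without knowing that the
inverse series converge there. -/
theorem momentSeries_mul :
    momentSeries q c * (levelOneDenom q c - C c * X) = levelOneDenom q c := by
  linear_combination levelOneDenom q c * momentSeries_eq q c +
    C c * X * momentSeries q c * levelOneDenom_mul_inv q c

theorem levelSeries_zero :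
    levelSeries q c 0 = 1 + C (weight q c 0) * X * levelSeries q c 1 := by
  simpa [levelSeries, weight] using momentSeries_eq q c

/-- Split paths by their first step, down or up, with weights on up-steps. From level 1 this is the
equation defining the inverse of E; from higher levels it is the Catalan equation. -/
theorem levelSeries_succ (k : ℕ) : levelSeries q c (k + 1) =
    levelSeries q c k + C (weight q c (k + 1)) * X * levelSeries q c (k + 2) := by
  match k with
  | 0 =>
    have h := levelOneDenom_mul_inv q c
    rw [levelOneDenom] at h
    simp only [levelSeries, weight, zero_add, pow_zero, pow_one, mul_one]
    rw [levelOneDenom]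
    linear_combination momentSeries q c * h
  | k + 1 =>
    simp only [levelSeries, weight]
    linear_combination momentSeries q c * (levelOneDenom q c)⁻¹ * scaledCatalan c ^ k *
      scaledCatalan_eq c

variable {q c}

/-- A solution of the recurrence of the Jacobi matrix with the weights `c, (1 + q) c, c, c, …` is
given by the coefficients of the level series. -/
theorem eq_coeff_levelSeries {p : ℕ → ℕ → ℂ} (h00 : p 0 0 = 1) (hk0 : ∀ k, p (k + 1) 0 = 0)
    (h0 : ∀ N, p 0 (N + 1) = p 1 N)
    (hk : ∀ k N, p (k + 1) (N + 1) = p (k + 2) N + weight q c k * p k N) (n : ℕ) :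
    p 0 (2 * n) = coeff n (momentSeries q c) := by
  -- Fewer than k steps cannot lead from level k to level 0.
  have hvan : ∀ N k, N < k → p k N = 0 := by
    intro N
    induction N with
    | zero =>
      intro k h
      obtain ⟨k, rfl⟩ := Nat.exists_eq_succ_of_ne_zero h.ne'
      exact hk0 k
    | succ N ih =>
      intro k h
      obtain ⟨k, rfl⟩ := Nat.exists_eq_succ_of_ne_zero (Nat.ne_of_gt (Nat.zero_lt_of_lt h))
      rw [Nat.succ_eq_add_one, hk, ih _ (by omega), ih _ (by omega)]
      simp
  -- A path of length k + 2j from level k to 0 has j up-steps. The recurrence for `p` weights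
  -- down-steps, the level series up-steps; the product accounts for the k unmatched down-steps.
  -- Nothing is divided by a weight, so q = -1 is covered.
  have key : ∀ j k, p k (k + 2 * j) =
      (∏ i ∈ Finset.range k, weight q c i) * coeff j (levelSeries q c k) := by
    intro j
    induction j with
    | zero =>
      intro k
      induction k with
      | zero =>
        rw [levelSeries_zero]
        simp [h00]
      | succ k ih =>
        rw [mul_zero, add_zero] at ih ⊢
        rw [hk, hvan k (k + 2) (by omega), ih, levelSeries_succ, Finset.prod_range_succ]
        simp [mul_assoc]
        ring
    | succ j ihj =>
      intro k
      induction k with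
      | zero =>
        have h1 := ihj 1
        rw [show 0 + 2 * (j + 1) = (1 + 2 * j) + 1 by ring, h0, h1, levelSeries_zero]
        simp [mul_assoc, coeff_succ_X_mul, coeff_one]
      | succ k ih =>
        have h1 := ihj (k + 2)
        rw [show k + 1 + 2 * (j + 1) = (k + 2 + 2 * j) + 1 by ring, hk, h1,
          show k + 2 + 2 * j = k + 2 * (j + 1) by ring, ih, levelSeries_succ q c k,
          Finset.prod_range_succ, Finset.prod_range_succ]
        rw [map_add, mul_assoc (C _), coeff_C_mul, coeff_succ_X_mul]
        ring
  simpa [levelSeries] using key n 0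

end Jacobi

/-! ### The Jacobi recurrence in the Fock space. -/

section Fock

universe u

variable {H : Type u} [NormedAddCommGroup H] [InnerProductSpace ℂ H]

theorem tprod_const_succ (f : H) (n : ℕ) :
    PiTensorProduct.tprod ℂ (fun _ : Fin (n + 1) => f) =
      consTensor f n (PiTensorProduct.tprod ℂ fun _ : Fin n => f) := by
  rw [consTensor_tprod]
  congr 1
  ext i
  refine Fin.cases ?_ (fun j => ?_) i <;> simp

/-- The exchange is symmetric and fixes f^{⊗n}, so it may be dropped beside this vector: λₙ
contributes 1 for n ≤ 1 and 1 + q for n ≥ 2. In passing from n to n + 1 these factors cancel except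
at n = 1. -/
theorem qInner_tprod_const_consTensor (q : ℝ) (f : H) (n : ℕ) (F : ⨂[ℂ]^n H) :
    qInner q (PiTensorProduct.tprod ℂ fun _ : Fin (n + 1) => f) (consTensor f n F) =
      weight q (‖f‖ ^ 2 : ℝ) n * qInner q (PiTensorProduct.tprod ℂ fun _ : Fin n => f) F := by
  have hf : inner ℂ f f = ((‖f‖ ^ 2 : ℝ) : ℂ) := by
    rw [inner_self_eq_norm_sq_to_K]; norm_cast
  have hswap (m : ℕ) (G : ⨂[ℂ]^(m + 2) H) :
      tensorInner (PiTensorProduct.tprod ℂ fun _ : Fin (m + 2) => f) (swapLast m G) =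
        tensorInner (PiTensorProduct.tprod ℂ fun _ : Fin (m + 2) => f) G := by
    rw [← tensorInner_swapLast_left, swapLast_tprod]
  match n with
  | 0 =>
    simp only [qInner, lam, LinearMap.id_apply, weight]
    rw [tprod_const_succ, tensorInner_consTensor, hf]
  | 1 =>
    simp only [qInner, lam, LinearMap.add_apply, LinearMap.smul_apply, LinearMap.id_apply, weight,
      tensorInner_add_right, tensorInner_smul_right]
    rw [hswap, tprod_const_succ f 1, tensorInner_consTensor, hf]
    ring
  | n + 2 =>
    simp only [qInner, lam, LinearMap.add_apply, LinearMap.smul_apply, LinearMap.id_apply, weight,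
      tensorInner_add_right, tensorInner_smul_right]
    rw [hswap, hswap, tprod_const_succ f (n + 2), tensorInner_consTensor, hf]
    ring

variable (q : Set.Icc (-1 : ℝ) 1)

theorem inner_simpleTensor_const_particleCreation (f : H) (n : ℕ) (F : Particle q H n) :
    inner ℂ (simpleTensor q fun _ : Fin (n + 1) => f) (particleCreation q f n F) =
      weight (q : ℝ) (‖f‖ ^ 2 : ℝ) n * inner ℂ (simpleTensor q fun _ : Fin n => f) F := by
  induction F using UniformSpace.Completion.induction_on with
  | hp => exact isClosed_eq (by fun_prop) (by fun_prop)
  | ih F =>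
    rw [particleCreation, ContinuousLinearMap.completion_apply_coe, simpleTensor, simpleTensor,
      UniformSpace.Completion.inner_coe, UniformSpace.Completion.inner_coe]
    exact qInner_tprod_const_consTensor q f n F

/-- The vector `f ⊗ ⋯ ⊗ f` in the Fock space. -/
noncomputable def tensorPower (f : H) (n : ℕ) : Fock q H :=
  lp.single 2 n (simpleTensor q fun _ : Fin n => f)

theorem vacuum_eq_tensorPower (f : H) : (vacuum q : Fock q H) = tensorPower q f 0 := by
  rw [vacuum, tensorPower]
  congr 2
  exact Subsingleton.elim _ _

theorem inner_tensorPower (f : H) (n : ℕ) (ψ : Fock q H) :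
    inner ℂ (tensorPower q f n) ψ = inner ℂ (simpleTensor q fun _ : Fin n => f) (ψ n) :=
  lp.inner_single_left n _ ψ

theorem inner_tensorPower_zero_vacuum (f : H) :
    inner ℂ (tensorPower q f 0) (vacuum q) = 1 := by
  rw [vacuum_eq_tensorPower q f, inner_tensorPower, tensorPower, lp.single_apply_self,
    simpleTensor, UniformSpace.Completion.inner_coe]
  exact (tensorInner_tprod _ _).trans (by simp)

theorem norm_vacuum : ‖(vacuum q : Fock q H)‖ = 1 := by
  have h := inner_tensorPower_zero_vacuum q (0 : H)
  rw [← vacuum_eq_tensorPower, inner_self_eq_norm_sq_to_K] at h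
  have h' : ‖(vacuum q : Fock q H)‖ ^ 2 = 1 := Complex.ofReal_injective (by simpa using h)
  exact (pow_eq_one_iff_of_nonneg (norm_nonneg _) two_ne_zero).mp h'

theorem inner_tensorPower_succ_vacuum (f : H) (n : ℕ) :
    inner ℂ (tensorPower q f (n + 1)) (vacuum q) = 0 := by
  rw [inner_tensorPower, vacuum, lp.single_apply_ne _ _ _ (Nat.succ_ne_zero n), inner_zero_right]

theorem creation_apply_zero (f : H) (ψ : Fock q H) : creation q f ψ 0 = 0 := rfl

theorem creation_apply_succ (f : H) (ψ : Fock q H) (n : ℕ) :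
    creation q f ψ (n + 1) = particleCreation q f n (ψ n) := rfl

theorem creation_tensorPower (f : H) (n : ℕ) :
    creation q f (tensorPower q f n) = tensorPower q f (n + 1) := by
  ext k
  cases k with
  | zero =>
    rw [creation_apply_zero, tensorPower, lp.single_apply_ne _ _ _ (Nat.succ_ne_zero n).symm]
  | succ k =>
    rw [creation_apply_succ]
    by_cases h : k = n
    · subst h
      rw [tensorPower, tensorPower, lp.single_apply_self, lp.single_apply_self,
        particleCreation_simpleTensor]
      congr 1
      ext i
      refine Fin.cases ?_ (fun j => ?_) i <;> simp
    · rw [tensorPower, tensorPower, lp.single_apply_ne _ _ _ h,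
        lp.single_apply_ne _ _ _ (by omega), map_zero]

/-- At level 0 there is no downward term, because the range of A⁺(f) has no vacuum component. -/
theorem inner_tensorPower_zero_field (f : H) (ψ : Fock q H) :
    inner ℂ (tensorPower q f 0) (field q f ψ) = inner ℂ (tensorPower q f 1) ψ := by
  rw [field, _root_.add_apply, inner_add_right, annihilation,
    ContinuousLinearMap.adjoint_inner_right, creation_tensorPower,
    inner_tensorPower q f 0, creation_apply_zero, inner_zero_right, add_zero]

theorem inner_tensorPower_succ_field (f : H) (n : ℕ) (ψ : Fock q H) :
    inner ℂ (tensorPower q f (n + 1)) (field q f ψ) =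
      inner ℂ (tensorPower q f (n + 2)) ψ +
        weight (q : ℝ) (‖f‖ ^ 2 : ℝ) n * inner ℂ (tensorPower q f n) ψ := by
  rw [field, _root_.add_apply, inner_add_right, annihilation,
    ContinuousLinearMap.adjoint_inner_right, creation_tensorPower,
    inner_tensorPower q f (n + 1), creation_apply_succ,
    inner_simpleTensor_const_particleCreation, inner_tensorPower q f n]

theorem moment_eq_coeff (f : H) (n : ℕ) :
    moment q f n = PowerSeries.coeff n (momentSeries (q : ℝ) (‖f‖ ^ 2 : ℝ)) := by
  have := eq_coeff_levelSeries (q := ((q : ℝ) : ℂ)) (c := ((‖f‖ ^ 2 : ℝ) : ℂ))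
    (p := fun k N => inner ℂ (tensorPower q f k) ((field q f ^ N) (vacuum q)))
    (by simpa using inner_tensorPower_zero_vacuum q f)
    (fun k => by simpa using inner_tensorPower_succ_vacuum q f k)
    (fun N => by rw [pow_succ']; exact inner_tensorPower_zero_field q f _)
    (fun k N => by rw [pow_succ']; exact inner_tensorPower_succ_field q f k _) n
  rw [← this, moment, vacuum_eq_tensorPower q f]

theorem norm_moment_le (f : H) (n : ℕ) : ‖moment q f n‖ ≤ (‖field q f‖ ^ 2) ^ n := by
  calc ‖moment q f n‖ ≤ ‖(vacuum q : Fock q H)‖ * ‖(field q f ^ (2 * n)) (vacuum q)‖ :=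
        norm_inner_le_norm _ _
    _ ≤ ‖field q f ^ (2 * n)‖ := by
        have := (field q f ^ (2 * n)).le_opNorm (vacuum q)
        rw [norm_vacuum, mul_one] at this
        rwa [norm_vacuum, one_mul]
    _ ≤ ‖field q f‖ ^ (2 * n) := by
        have h1 : ‖(1 : Fock q H →L[ℂ] Fock q H)‖ ≤ 1 := ContinuousLinearMap.norm_id_le
        cases n with
        | zero => simpa using h1
        | succ n => exact norm_pow_le' _ (by omega)
    _ = _ := pow_mul _ _ _

end Fock

end QTwoFock

/-! ### Convergence near 0 and evaluation of the series. -/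

theorem theorem2p4 {H : Type*} [NormedAddCommGroup H] [InnerProductSpace ℂ H] [CompleteSpace H]
    (q : Set.Icc (-1 : ℝ) 1) (f : H) :
    -- the series defining `T_q` converges on some interval around `0`
    (∃ ε_f : ℝ, 0 < ε_f ∧ ∀ x ∈ Set.Ioo (-ε_f) ε_f,
      Summable fun n : ℕ => (x : ℂ) ^ n * QTwoFock.moment q f n) ∧
    -- on every such interval, cut down to `4 ‖f‖² |x| < 1`, its sum is given by the formula
    ∀ ε_f : ℝ, 0 < ε_f →
      (∀ x ∈ Set.Ioo (-ε_f) ε_f,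
        Summable fun n : ℕ => (x : ℂ) ^ n * QTwoFock.moment q f n) →
      ∀ x ∈ Set.Ioo (-ε_f) ε_f, 4 * ‖f‖ ^ 2 * |x| < 1 →
        1 - (q : ℝ) + (1 + (q : ℝ)) * √(1 - 4 * ‖f‖ ^ 2 * x) - 2 * ‖f‖ ^ 2 * x ≠ 0 ∧
        HasSum (fun n : ℕ => (x : ℂ) ^ n * QTwoFock.moment q f n)
          (((1 - (q : ℝ) + (1 + (q : ℝ)) * √(1 - 4 * ‖f‖ ^ 2 * x)) /
            (1 - (q : ℝ) + (1 + (q : ℝ)) * √(1 - 4 * ‖f‖ ^ 2 * x) - 2 * ‖f‖ ^ 2 * x) : ℝ) : ℂ) := by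
  constructor
  · set M := ‖QTwoFock.field q f‖ ^ 2 with hM
    have hM0 : 0 ≤ M := by positivity
    -- Moments are at most M^n in norm; the 1 added to M avoids dividing by zero when the field
    -- operator vanishes.
    refine ⟨1 / (M + 1), by positivity, fun x hx => ?_⟩
    have hx' : |x| < 1 / (M + 1) := abs_lt.mpr hx
    have h1 : |x| * M < 1 := by
      rw [lt_div_iff₀ (by positivity)] at hx'
      nlinarith [abs_nonneg x]
    refine Summable.of_norm_bounded (summable_geometric_of_lt_one (by positivity) h1) fun n => ?_
    rw [norm_mul, norm_pow, Complex.norm_real, Real.norm_eq_abs, mul_pow]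
    gcongr
    exact QTwoFock.norm_moment_le q f n
  · intro ε _ hε x hx hx4
    set c := ‖f‖ ^ 2 with hc
    have hy : 4 * |c * x| < 1 := by
      rw [abs_mul, abs_of_nonneg (by positivity : 0 ≤ c)]
      linarith
    obtain ⟨s, hs, hsr⟩ := QTwoFock.exists_hasSumAt_scaledCatalan hy
    rw [← mul_assoc, ← mul_assoc] at hsr
    set r := √(1 - 4 * c * x) with hr
    have hT := (hε x hx).hasSum
    set T := ∑' n : ℕ, (x : ℂ) ^ n * QTwoFock.moment q f n
    have hT' : QTwoFock.HasSumAt x (QTwoFock.momentSeries (q : ℝ) c) T := by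
      simpa only [QTwoFock.HasSumAt, ← QTwoFock.moment_eq_coeff q f, hc] using hT
    have hE : QTwoFock.HasSumAt x (QTwoFock.levelOneDenom (q : ℝ) c)
        (1 - (1 + (q : ℝ)) * c * x * s) :=
      (QTwoFock.HasSumAt.one x).sub
        (((QTwoFock.HasSumAt.C x _).mul (QTwoFock.HasSumAt.X x)).mul hs)
    have hprod := hT'.mul (hE.sub ((QTwoFock.HasSumAt.C x c).mul (QTwoFock.HasSumAt.X x)))
    rw [QTwoFock.momentSeries_mul] at hprod
    have heq := hE.unique hprod
    -- Twice the evaluated identity, using 2E(x) = 2 - (1 + q)(1 - r) = 1 - q + (1 + q)r.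
    have heq' : T * ((1 - (q : ℝ) + (1 + (q : ℝ)) * r - 2 * c * x : ℝ) : ℂ) =
        ((1 - (q : ℝ) + (1 + (q : ℝ)) * r : ℝ) : ℂ) := by
      push_cast
      linear_combination (-2 : ℂ) * heq + (1 + ((q : ℝ) : ℂ)) * (T - 1) * hsr
    -- A zero denominator would force a zero numerator, hence cx = 0 and r = 1; but then the
    -- numerator is 2.
    have hD : 1 - (q : ℝ) + (1 + (q : ℝ)) * r - 2 * c * x ≠ 0 := by
      intro h0
      rw [h0, Complex.ofReal_zero, mul_zero] at heq'
      have h1 : 1 - (q : ℝ) + (1 + (q : ℝ)) * r = 0 := by exact_mod_cast heq'.symm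
      have h2 : c * x = 0 := by linarith
      have h3 : r = 1 := by rw [hr, mul_assoc, h2]; simp
      rw [h3] at h1
      linarith
    refine ⟨hD, ?_⟩
    convert hT using 1
    rw [Complex.ofReal_div, ← heq', mul_div_cancel_right₀]
    exact_mod_cast hD
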